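/- Let $G$ be a finite, simple, connected graph drawn in the plane, that is, distinct vertices are represented by distinct points of $\mathbb{R}^2$, every edge by a simple arc joining its two endpoints and passing through no other vertex, and the arcs of two different edges meet only in common endpoints. Let $F$ be the number of regions of the drawing, i.e. the number of connected components of the complement of the drawing in $\mathbb{R}^2$ (the unbounded region included), and let $C(G)$ be the set of induced cycles of $G$, i.e. of the induced subgraphs of $G$ that are cycles (of length at least $3$). If $|C(G)| \le F+2$, then $\chi(G) \le 4$. -/

import Mathlib

/-- The plane `ℝ²`. -/
abbrev Plane : Type := EuclideanSpace ℝ (Fin 2)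

/-- A drawing of a simple graph in the plane: distinct vertices are distinct points, every edge is
a simple arc (the range of an injective path) joining the points of its two endpoints, an arc
passes through no vertex other than its endpoints, and two different arcs meet at most in (the
points of) common endpoints. -/
structure PlaneDrawing {V : Type*} (G : SimpleGraph V) where
  /-- the point that represents a vertex -/
  point : V → Plane
  /-- the set of points of the arc that represents an edge -/
  arc : G.edgeSet → Set Plane
  point_injective : Function.Injective point
  arc_isArc : ∀ (u v : V) (h : G.Adj u v), ∃ γ : Path (point u) (point v),
    Function.Injective γ ∧ Set.range γ = arc ⟨s(u, v), h⟩
  mem_of_point_mem_arc : ∀ (w : V) (e : G.edgeSet), point w ∈ arc e → w ∈ (e : Sym2 V)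
  arc_inter_arc : ∀ e f : G.edgeSet, e ≠ f →
    arc e ∩ arc f ⊆ point '' {v | v ∈ (e : Sym2 V) ∧ v ∈ (f : Sym2 V)}

namespace PlaneDrawing

/-- The set of all points of the plane that lie on the drawing. -/
def support {V : Type*} {G : SimpleGraph V} (D : PlaneDrawing G) : Set Plane :=
  Set.range D.point ∪ ⋃ e, D.arc e

/-- The number of regions of a drawing (the unbounded one included): the number of connected
components of the complement of the drawing in the plane. -/
noncomputable def numRegions {V : Type*} {G : SimpleGraph V} (D : PlaneDrawing G) : ℕ :=
  Nat.card (ConnectedComponents ↥(D.support)ᶜ)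

end PlaneDrawing

namespace SimpleGraph

/-- The set of induced cycles of `G`: the induced subgraphs of `G` that are isomorphic to a cycle
of some length `n ≥ 3` (triangles included). -/
def inducedCycles {V : Type*} (G : SimpleGraph V) : Set G.Subgraph :=
  {H | H.IsInduced ∧ ∃ n : ℕ, 3 ≤ n ∧ Nonempty (H.coe ≃g SimpleGraph.cycleGraph n)}

end SimpleGraph

/-!
If `G` is not `n`-colourable, some nonempty `W` induces a subgraph of minimum degree at least `n`.
Such a subgraph has a vertex `v` with `n` neighbours that are pairwise joined by induced paths
avoiding the other neighbours of `v`. Each of these paths closes up to an induced cycle through `v`,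
so deleting `v` lowers the difference between the number of induced cycles and the cyclomatic number
by at least `(n - 1).choose 2`. The remaining subgraph has minimum degree at least `n - 1`, and no
deletion of a vertex raises the difference, so for `G` it is at least `n.choose 3`.

On the other side, the number of regions is at most the cyclomatic number plus one. With one point
`p i` in each bounded region, a product of powers of the functions `z - p i` with a continuous
logarithm on the drawing is trivial, as winding numbers show, while the obstruction to such a
logarithm lies in the first cohomology of the graph, whose rank is the cyclomatic number.
-/

open SimpleGraph

section GraphRank

variable {V : Type*} {G : SimpleGraph V}

lemma apply_eq_of_reachable {α : Type*} {f : V → α} (hf : ∀ u v, G.Adj u v → f u = f v) {u v : V}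
    (h : G.Reachable u v) : f u = f v := by
  obtain ⟨p⟩ := h
  induction p with
  | nil => rfl
  | cons hadj _ ih => exact (hf _ _ hadj).trans ih

lemma eq_zero_of_apply_out_eq_zero {M : Type*} [Zero M] {d : V → M}
    (hd : ∀ u v, G.Adj u v → d u = d v) (h0 : ∀ c : G.ConnectedComponent, d c.out = 0) : d = 0 := by
  funext v
  have hv : G.Reachable (G.connectedComponentMk v).out v :=
    ConnectedComponent.exact (Quot.out_eq (G.connectedComponentMk v))
  exact (apply_eq_of_reachable hd hv).symm.trans (h0 _)

lemma exists_edgeSet_eq_mk (G : SimpleGraph V) :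
    ∃ a b : G.edgeSet → V, ∀ e : G.edgeSet, (e : Sym2 V) = s(a e, b e) :=
  ⟨fun e => e.1.out.1, fun e => e.1.out.2, fun e => e.1.out_eq.symm⟩

/-- The coboundaries have rank `|V|` minus the number of components, so a larger number of cochains
has a nontrivial combination that is a coboundary. -/
theorem exists_sum_mul_eq_sub [Finite V] {a b : G.edgeSet → V}
    (hab : ∀ e : G.edgeSet, (e : Sym2 V) = s(a e, b e)) {ι : Type*} [Fintype ι]
    (c : ι → G.edgeSet → ℤ)
    (hcard : G.edgeSet.ncard + Nat.card G.ConnectedComponent < Fintype.card ι + Nat.card V) :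
    ∃ k : ι → ℤ, k ≠ 0 ∧ ∃ d : V → ℤ, ∀ e, ∑ i, k i * c i e = d (b e) - d (a e) := by
  have := Fintype.ofFinite V
  have := Fintype.ofFinite G.edgeSet
  have := Fintype.ofFinite G.ConnectedComponent
  let M : (ι → ℤ) × (V → ℤ) →ₗ[ℤ] (G.edgeSet → ℤ) × (G.ConnectedComponent → ℤ) :=
    ((Fintype.linearCombination ℤ c).coprod
      (LinearMap.funLeft ℤ ℤ a - LinearMap.funLeft ℤ ℤ b)).prod
      (LinearMap.funLeft ℤ ℤ Quot.out ∘ₗ LinearMap.snd ℤ _ _)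
  have hM : ¬ Function.Injective M := fun hinj => by
    have hle := LinearMap.finrank_le_finrank_of_injective hinj
    simp only [Module.finrank_prod, Module.finrank_pi] at hle
    rw [← Nat.card_coe_set_eq] at hcard
    simp only [Nat.card_eq_fintype_card] at hcard
    omega
  rw [injective_iff_map_eq_zero] at hM
  push Not at hM
  obtain ⟨⟨k, d⟩, hkd, hne⟩ := hM
  obtain ⟨hedge, hroot⟩ := Prod.ext_iff.1 hkd
  have hsum : ∀ e, ∑ i, k i * c i e = d (b e) - d (a e) := fun e => by
    have he : (Fintype.linearCombination ℤ c k) e + (d (a e) - d (b e)) = 0 := congrFun hedge e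
    rw [Fintype.linearCombination_apply, Finset.sum_apply] at he
    simp only [Pi.smul_apply, smul_eq_mul] at he
    linarith
  refine ⟨k, ?_, d, hsum⟩
  rintro rfl
  refine hne (Prod.ext rfl (eq_zero_of_apply_out_eq_zero (G := G) ?_ (congrFun hroot)))
  intro u v huv
  have hd := hsum ⟨s(u, v), huv⟩
  simp only [Pi.zero_apply, zero_mul, Finset.sum_const_zero] at hd
  rcases Sym2.eq_iff.1 (hab ⟨s(u, v), huv⟩) with ⟨hu, hv⟩ | ⟨hv, hu⟩ <;>
    rw [← hu, ← hv] at hd <;> dsimp only <;> linarith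

theorem card_le_ncard_edgeSet_add_card_connectedComponent [Finite V] (G : SimpleGraph V) :
    Nat.card V ≤ G.edgeSet.ncard + Nat.card G.ConnectedComponent := by
  by_contra! hlt
  obtain ⟨a, b, hab⟩ := exists_edgeSet_eq_mk G
  obtain ⟨k, hk, -⟩ := exists_sum_mul_eq_sub (ι := Empty) hab (fun i => i.elim) (by simpa using hlt)
  exact hk (Subsingleton.elim _ _)

lemma card_connectedComponent_le_of_adj_reachable [Finite V] {H : SimpleGraph V}
    (h : ∀ u v, G.Adj u v → H.Reachable u v) :
    Nat.card H.ConnectedComponent ≤ Nat.card G.ConnectedComponent := by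
  have hr : ∀ u v, G.Reachable u v → H.connectedComponentMk u = H.connectedComponentMk v :=
    fun u v => apply_eq_of_reachable fun x y hxy => ConnectedComponent.sound (h x y hxy)
  refine Nat.card_le_card_of_surjective
    (ConnectedComponent.lift H.connectedComponentMk fun u v p _ => hr u v ⟨p⟩) fun c => ?_
  induction c using ConnectedComponent.ind with
  | _ v => exact ⟨G.connectedComponentMk v, rfl⟩

theorem card_add_choose_le_of_isClique [Finite V] {K : Set V} {k : ℕ} (hK : G.IsClique K)
    (hk : K.ncard = k + 1) :
    Nat.card V + k.choose 2 ≤ G.edgeSet.ncard + Nat.card G.ConnectedComponent := by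
  classical
  have := Fintype.ofFinite V
  obtain ⟨h, hh⟩ : K.Nonempty := Set.nonempty_of_ncard_ne_zero (by omega)
  let K' : Finset V := (K \ {h}).toFinset
  have hK' : K'.card = k := by
    rw [← Set.ncard_eq_toFinset_card', Set.ncard_sdiff_singleton_of_mem hh, hk,
      add_tsub_cancel_right]
  let S : Set (Sym2 V) := ↑(K'.offDiag.image Sym2.mk.uncurry)
  have hS : ∀ x y, s(x, y) ∈ S ↔ (x ∈ K ∧ x ≠ h) ∧ (y ∈ K ∧ y ≠ h) ∧ x ≠ y := fun x y => by
    simp only [S, K', Finset.mem_coe, Finset.mem_image, Finset.mem_offDiag, Set.mem_toFinset,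
      Set.mem_sdiff, Set.mem_singleton_iff, Prod.exists, Function.uncurry_apply_pair, Sym2.eq_iff]
    grind
  have hSG : S ⊆ G.edgeSet := fun e => by
    induction e with
    | _ x y => exact fun he => hK ((hS x y).1 he).1.1 ((hS x y).1 he).2.1.1 ((hS x y).1 he).2.2
  have hhub : ∀ x ∈ K, x ≠ h → (G.deleteEdges S).Adj h x := fun x hx hxh =>
    deleteEdges_adj.2 ⟨hK hh hx hxh.symm, fun he => ((hS h x).1 he).1.2 rfl⟩
  have hreach : ∀ x y, G.Adj x y → (G.deleteEdges S).Reachable x y := fun x y hxy => by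
    by_cases he : s(x, y) ∈ S
    · obtain ⟨⟨hx, hxh⟩, ⟨hy, hyh⟩, -⟩ := (hS x y).1 he
      exact (hhub x hx hxh).symm.reachable.trans (hhub y hy hyh).reachable
    · exact (deleteEdges_adj.2 ⟨hxy, he⟩).reachable
  have hle := card_le_ncard_edgeSet_add_card_connectedComponent (G.deleteEdges S)
  have hcomp := card_connectedComponent_le_of_adj_reachable hreach
  have hE := Set.ncard_sdiff_add_ncard_of_subset hSG
  have hScard : S.ncard = k.choose 2 := by
    rw [Set.ncard_coe_finset, Sym2.card_image_offDiag, hK']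
  rw [edgeSet_deleteEdges] at hle
  omega

end GraphRank

section InducedCycle

variable {V : Type*} {G : SimpleGraph V}

lemma dist_getVert_getVert {x y : V} {p : G.Walk x y} (hp : p.length = G.dist x y) {i j : ℕ}
    (hij : i ≤ j) (hj : j ≤ p.length) : G.dist (p.getVert i) (p.getVert j) = j - i := by
  have hsub : ((p.drop i).take (j - i)).IsSubwalk p :=
    (Walk.isSubwalk_take _ _).trans (Walk.isSubwalk_drop _ _)
  have h := length_eq_dist_of_subwalk hp hsub
  rw [Walk.take_length, Walk.drop_length, Walk.drop_getVert, Nat.add_sub_cancel' hij] at h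
  omega

lemma adj_getVert_iff {x y : V} {p : G.Walk x y} (hp : p.length = G.dist x y) {i j : ℕ}
    (hij : i ≤ j) (hj : j ≤ p.length) : G.Adj (p.getVert i) (p.getVert j) ↔ i + 1 = j := by
  rw [← dist_eq_one_iff_adj, dist_getVert_getVert hp hij hj]
  omega

theorem exists_pathGraph_embedding (hG : G.Connected) (x y : V) :
    ∃ f : pathGraph (G.dist x y + 1) ↪g G, f 0 = x ∧ f (Fin.last _) = y := by
  obtain ⟨p, hp⟩ := hG.exists_walk_length_eq_dist x y
  refine ⟨⟨⟨fun i => p.getVert i, fun i j hij => ?_⟩, fun {i j} => ?_⟩, p.getVert_zero,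
    hp ▸ p.getVert_length⟩
  · have hinj := (p.isPath_of_length_eq_dist hp).getVert_injOn
    exact Fin.ext (hinj (i.is_le.trans_eq hp.symm) (j.is_le.trans_eq hp.symm) hij)
  · rw [pathGraph_adj]
    rcases le_total i j with h | h
    · refine (adj_getVert_iff hp (Fin.le_def.1 h) (by omega)).trans ?_
      omega
    · refine (G.adj_comm _ _).trans ((adj_getVert_iff hp (Fin.le_def.1 h) (by omega)).trans ?_)
      omega

lemma exists_pathGraph_embedding_of_mem {T : Set V} (hT : (G.induce T).Connected) {x y : V}
    (hx : x ∈ T) (hy : y ∈ T) : ∃ (l : ℕ) (f : pathGraph (l + 1) ↪g G),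
      Set.range f ⊆ T ∧ f 0 = x ∧ f (Fin.last l) = y := by
  obtain ⟨f, hf0, hfl⟩ := exists_pathGraph_embedding hT ⟨x, hx⟩ ⟨y, hy⟩
  exact ⟨_, f.trans (Embedding.induce T), Set.range_subset_iff.2 fun i => (f i).2,
    congrArg Subtype.val hf0, congrArg Subtype.val hfl⟩

lemma cycleGraph_adj_of_lt {n : ℕ} {i j : Fin n} (hij : i < j) :
    (cycleGraph n).Adj i j ↔ (i : ℕ) + 1 = j ∨ (i : ℕ) = 0 ∧ (j : ℕ) + 1 = n := by
  have hsub : ((i - j : Fin n) : ℕ) = n - j + i := by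
    rw [Fin.sub_def]
    exact Nat.mod_eq_of_lt (by omega)
  rw [cycleGraph_adj', Fin.sub_val_of_le hij.le, hsub]
  omega

lemma cycleGraph_adj_succ_succ {l : ℕ} {i j : Fin (l + 1)} :
    (cycleGraph (l + 2)).Adj i.succ j.succ ↔ (pathGraph (l + 1)).Adj i j := by
  wlog hij : i ≤ j generalizing i j
  · rw [adj_comm, this (le_of_not_ge hij), adj_comm]
  · rcases hij.eq_or_lt with rfl | hij
    · simp
    · rw [pathGraph_adj, cycleGraph_adj_of_lt (Fin.succ_lt_succ_iff.2 hij)]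
      simp only [Fin.val_succ]
      omega

lemma cycleGraph_adj_zero_succ {l : ℕ} {i : Fin (l + 1)} :
    (cycleGraph (l + 2)).Adj 0 i.succ ↔ i = 0 ∨ i = Fin.last l := by
  rw [cycleGraph_adj_of_lt (Fin.succ_pos i), Fin.ext_iff, Fin.ext_iff]
  simp only [Fin.val_succ, Fin.val_zero, Fin.val_last, true_and]
  omega

theorem exists_cycleGraph_embedding {l : ℕ} (f : pathGraph (l + 1) ↪g G) {v : V}
    (hv : v ∉ Set.range f) (hadj : ∀ i, G.Adj v (f i) ↔ i = 0 ∨ i = Fin.last l) :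
    ∃ g : cycleGraph (l + 2) ↪g G, Set.range g = insert v (Set.range f) := by
  refine ⟨⟨⟨Fin.cons v f, Fin.cons_injective_iff.2 ⟨hv, f.injective⟩⟩, fun {i j} => ?_⟩,
    Fin.range_cons v f⟩
  induction i using Fin.cases with
  | zero =>
    induction j using Fin.cases with
    | zero => simp
    | succ j => exact (hadj j).trans cycleGraph_adj_zero_succ.symm
  | succ i =>
    induction j using Fin.cases with
    | zero => exact (G.adj_comm _ _).trans ((hadj i).trans (cycleGraph_adj_zero_succ.symm.trans
        (adj_comm _ _ _)))
    | succ j => exact f.map_adj_iff.trans cycleGraph_adj_succ_succ.symm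

lemma induce_range_mem_inducedCycles {n : ℕ} (hn : 3 ≤ n) (f : cycleGraph n ↪g G) :
    (⊤ : G.Subgraph).induce (Set.range f) ∈ G.inducedCycles := by
  refine ⟨(Subgraph.isInduced_iff_exists_eq_induce_top _).2 ⟨_, rfl⟩, n, hn, ?_⟩
  rw [← induce_eq_coe_induce_top]
  exact ⟨f.isoInduceRange.symm⟩

/-- The induced cycles of `G` all of whose vertices lie in `W`. -/
def inducedCyclesIn (G : SimpleGraph V) (W : Set V) : Set G.Subgraph :=
  {H ∈ G.inducedCycles | H.verts ⊆ W}

/-- Two neighbours `x` and `y` of `v` are linked in `W` if some connected subset of `W` that avoids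
`v` contains no other neighbours of `v`; an induced cycle of `G` in `W` then passes through
`x`, `v`, `y`. -/
def Linked (G : SimpleGraph V) (W : Set V) (v x y : V) : Prop :=
  x ≠ y ∧ ∃ T ⊆ W \ {v}, (G.induce T).Connected ∧ T ∩ G.neighborSet v = {x, y}

namespace Linked

variable {W : Set V} {v x y : V}

lemma symm (h : Linked G W v x y) : Linked G W v y x := by
  obtain ⟨hne, T, hT, hc, hN⟩ := h
  exact ⟨hne.symm, T, hT, hc, hN.trans (Set.pair_comm x y)⟩

lemma mono {W' : Set V} (hW : W ⊆ W') (h : Linked G W v x y) : Linked G W' v x y := by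
  obtain ⟨hne, T, hT, h⟩ := h
  exact ⟨hne, T, hT.trans (Set.sdiff_subset_sdiff_left hW), h⟩

lemma of_adj (hx : x ∈ W ∩ G.neighborSet v) (hy : y ∈ W ∩ G.neighborSet v) (hxy : G.Adj x y) :
    Linked G W v x y :=
  ⟨hxy.ne, {x, y}, Set.pair_subset ⟨hx.1, hx.2.ne'⟩ ⟨hy.1, hy.2.ne'⟩,
    induce_pair_connected_of_adj hxy, Set.inter_eq_left.2 (Set.pair_subset hx.2 hy.2)⟩

theorem exists_mem_inducedCyclesIn (hv : v ∈ W) (h : Linked G W v x y) :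
    ∃ H ∈ inducedCyclesIn G W, v ∈ H.verts ∧ H.verts ∩ G.neighborSet v = {x, y} := by
  obtain ⟨hne, T, hT, hc, hN⟩ := h
  have hx : x ∈ T ∩ G.neighborSet v := hN ▸ Set.mem_insert x {y}
  have hy : y ∈ T ∩ G.neighborSet v := hN ▸ Set.mem_insert_of_mem x rfl
  obtain ⟨l, f, hfT, hf0, hfl⟩ := exists_pathGraph_embedding_of_mem hc hx.1 hy.1
  have hadj : ∀ i, G.Adj v (f i) ↔ i = 0 ∨ i = Fin.last l := fun i => by
    have hi : G.Adj v (f i) ↔ f i ∈ T ∩ G.neighborSet v := ⟨fun h => ⟨hfT ⟨i, rfl⟩, h⟩, And.right⟩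
    rw [hi, hN, Set.mem_insert_iff, Set.mem_singleton_iff, ← hf0, ← hfl, f.injective.eq_iff,
      f.injective.eq_iff]
  have hl : l ≠ 0 := by
    rintro rfl
    exact hne (hf0.symm.trans hfl)
  obtain ⟨g, hg⟩ := exists_cycleGraph_embedding f (fun h => (hT (hfT h)).2 rfl) hadj
  refine ⟨_, ⟨induce_range_mem_inducedCycles (by omega) g, ?_⟩, ?_, ?_⟩ <;>
    rw [Subgraph.induce_verts, hg]
  · exact Set.insert_subset hv (hfT.trans (hT.trans Set.sdiff_subset))
  · exact Set.mem_insert _ _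
  · rw [Set.insert_inter_of_notMem G.notMem_neighborSet_self]
    refine Set.Subset.antisymm (hN ▸ Set.inter_subset_inter_left _ hfT) (Set.pair_subset ?_ ?_)
    · exact ⟨⟨0, hf0⟩, hx.2⟩
    · exact ⟨⟨Fin.last l, hfl⟩, hy.2⟩

end Linked

end InducedCycle

section LinkGraph

variable {V : Type*} {G : SimpleGraph V} {W : Set V} {v : V}

/-- The graph on the neighbours of `v` in `W` in which two neighbours are adjacent if they are
linked. -/
def linkGraph (G : SimpleGraph V) (W : Set V) (v : V) : SimpleGraph ↥(W ∩ G.neighborSet v) where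
  Adj x y := Linked G W v x y
  symm := ⟨fun _ _ h => h.symm⟩
  loopless := ⟨fun _ h => h.1 rfl⟩

theorem ncard_inducedCyclesIn_sdiff_add_le [Finite V] (hv : v ∈ W) :
    (inducedCyclesIn G (W \ {v})).ncard + (linkGraph G W v).edgeSet.ncard ≤
      (inducedCyclesIn G W).ncard := by
  have hcycle : ∀ e ∈ (linkGraph G W v).edgeSet, ∃ H ∈ inducedCyclesIn G W, v ∈ H.verts ∧
      ∀ z : ↥(W ∩ G.neighborSet v), z ∈ e ↔ z.1 ∈ H.verts := fun e => by
    induction e with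
    | _ x y =>
      intro he
      obtain ⟨H, hH, hvH, hN⟩ := Linked.exists_mem_inducedCyclesIn hv he
      refine ⟨H, hH, hvH, fun z => ?_⟩
      have hz : z.1 ∈ H.verts ↔ z.1 ∈ H.verts ∩ G.neighborSet v :=
        ⟨fun h => ⟨h, z.2.2⟩, And.left⟩
      rw [hz, hN, Sym2.mem_iff, Subtype.ext_iff, Subtype.ext_iff]
      rfl
  choose! φ hφ hvφ hmem using hcycle
  have hinj : Set.InjOn φ (linkGraph G W v).edgeSet := fun e he e' he' h =>
    Sym2.ext fun z => by rw [hmem e he, hmem e' he', h]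
  have hdisj : Disjoint (inducedCyclesIn G (W \ {v})) (φ '' (linkGraph G W v).edgeSet) := by
    rw [Set.disjoint_right]
    rintro _ ⟨e, he, rfl⟩ h
    exact (h.2 (hvφ e he)).2 rfl
  rw [← hinj.ncard_image, ← Set.ncard_union_eq hdisj]
  refine Set.ncard_le_ncard (Set.union_subset (fun H hH => ?_) (Set.image_subset_iff.2 hφ))
  exact ⟨hH.1, hH.2.trans Set.sdiff_subset⟩

theorem ncard_edgeSet_induce_eq [Finite V] (hv : v ∈ W) :
    ((⊤ : G.Subgraph).induce W).edgeSet.ncard =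
      ((⊤ : G.Subgraph).induce (W \ {v})).edgeSet.ncard + (W ∩ G.neighborSet v).ncard := by
  have hinj : Set.InjOn (fun x => s(v, x)) (W ∩ G.neighborSet v) :=
    fun x _ y _ h => Sym2.congr_right.1 h
  rw [← hinj.ncard_image, ← Set.ncard_union_eq]
  · congr 1
    ext e
    induction e with
    | _ x y =>
      simp only [Subgraph.mem_edgeSet, Subgraph.induce_adj, Subgraph.top_adj, Set.mem_union,
        Set.mem_image, Set.mem_sdiff, Set.mem_singleton_iff, Set.mem_inter_iff, mem_neighborSet,
        Sym2.eq_iff]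
      grind [G.adj_comm x y]
  · rw [Set.disjoint_right]
    rintro _ ⟨x, -, rfl⟩ h
    exact h.1.2 rfl

lemma linkGraph_reachable_of_walk {x y : ↥(W ∩ G.neighborSet v)} (p : G.Walk x y)
    (hp : ∀ z ∈ p.support, z ∈ W \ {v}) : (linkGraph G W v).Reachable x y := by
  classical
  induction hn : p.length using Nat.strong_induction_on generalizing x y with
  | _ n ih =>
    subst hn
    by_cases hsplit : ∃ z ∈ p.support, G.Adj v z ∧ z ≠ x ∧ z ≠ y
    · obtain ⟨z, hz, hvz, hzx, hzy⟩ := hsplit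
      let z' : ↥(W ∩ G.neighborSet v) := ⟨z, (hp z hz).1, hvz⟩
      have hxz : (linkGraph G W v).Reachable x z' :=
        ih _ (p.length_takeUntil_lt_length hz hzy) (p.takeUntil z hz)
          (fun w hw => hp w (p.support_takeUntil_subset_support hz hw)) rfl
      have hzy : (linkGraph G W v).Reachable z' y :=
        ih _ (p.length_dropUntil_lt_length hz hzx) (p.dropUntil z hz)
          (fun w hw => hp w (p.support_dropUntil_subset_support hz hw)) rfl
      exact hxz.trans hzy
    · push Not at hsplit
      rcases eq_or_ne x y with rfl | hxy
      · rfl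
      · have hlink : Linked G W v x y := by
          refine ⟨Subtype.coe_ne_coe.2 hxy, {z | z ∈ p.support}, hp, p.connected_induce_support, ?_⟩
          refine Set.Subset.antisymm (fun z hz => ?_) (Set.pair_subset ?_ ?_)
          · exact or_iff_not_imp_left.2 (hsplit z hz.1 hz.2)
          · exact ⟨p.start_mem_support, x.2.2⟩
          · exact ⟨p.end_mem_support, y.2.2⟩
        exact Adj.reachable (G := linkGraph G W v) hlink

lemma mem_sdiff_of_mem_neighborSet {x : V} (hx : x ∈ W ∩ G.neighborSet v) : x ∈ W \ {v} :=
  ⟨hx.1, hx.2.ne'⟩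

lemma linkGraph_reachable {x y : ↥(W ∩ G.neighborSet v)}
    (h : (G.induce (W \ {v})).Reachable ⟨x, mem_sdiff_of_mem_neighborSet x.2⟩
      ⟨y, mem_sdiff_of_mem_neighborSet y.2⟩) : (linkGraph G W v).Reachable x y := by
  obtain ⟨p⟩ := h
  refine linkGraph_reachable_of_walk (p.map (Embedding.induce (G := G) (W \ {v})).toHom)
    fun z hz => ?_
  obtain ⟨w, -, rfl⟩ := List.mem_map.1 (Walk.support_map _ p ▸ hz)
  exact w.2

theorem card_connectedComponent_induce_add_le [Finite V] (hv : v ∈ W) :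
    Nat.card (G.induce W).ConnectedComponent + Nat.card (linkGraph G W v).ConnectedComponent ≤
      Nat.card (G.induce (W \ {v})).ConnectedComponent + 1 := by
  classical
  have := Fintype.ofFinite (G.induce W).ConnectedComponent
  let ψ : (G.induce (W \ {v})).ConnectedComponent → (G.induce W).ConnectedComponent :=
    ConnectedComponent.map (induceHomOfLE G Set.sdiff_subset).toHom
  let c₀ : (G.induce W).ConnectedComponent := (G.induce W).connectedComponentMk ⟨v, hv⟩
  have hsection : ∀ c : {c // c ≠ c₀}, ∃ d, ψ d = c := fun ⟨c, hc⟩ => by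
    induction c using ConnectedComponent.ind with
    | _ w =>
      have hw : w.1 ≠ v := by
        rintro rfl
        exact hc rfl
      exact ⟨(G.induce (W \ {v})).connectedComponentMk ⟨w, w.2, hw⟩, rfl⟩
  choose σ hσ using hsection
  let τ : (linkGraph G W v).ConnectedComponent → (G.induce (W \ {v})).ConnectedComponent :=
    fun c => (G.induce (W \ {v})).connectedComponentMk
      ⟨c.out, mem_sdiff_of_mem_neighborSet c.out.2⟩
  have hψτ : ∀ c, ψ (τ c) = c₀ := fun c => by
    refine ConnectedComponent.sound (Adj.reachable ?_)
    exact G.adj_symm c.out.2.2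
  have hτ : Function.Injective τ := fun c c' h => by
    rw [← Quot.out_eq c, ← Quot.out_eq c']
    exact ConnectedComponent.sound (linkGraph_reachable (ConnectedComponent.exact h))
  have hσ' : Function.Injective σ := fun c c' h => Subtype.ext (by rw [← hσ, ← hσ, h])
  have hle := Nat.card_le_card_of_injective _ (hσ'.sumElim hτ fun c c' h =>
    c.2 (by rw [← hσ, h, hψτ]))
  have hne : Nat.card {c // c ≠ c₀} = Nat.card (G.induce W).ConnectedComponent - 1 := by
    rw [Nat.card_eq_fintype_card, Nat.card_eq_fintype_card]
    exact Set.card_ne_eq c₀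
  rw [Nat.card_sum, hne] at hle
  omega

/-- For `W = V` this is the number of induced cycles minus the cyclomatic number of the graph. -/
noncomputable def cycleExcess (G : SimpleGraph V) (W : Set V) : ℤ :=
  (inducedCyclesIn G W).ncard + W.ncard - ((⊤ : G.Subgraph).induce W).edgeSet.ncard -
    Nat.card (G.induce W).ConnectedComponent

theorem cycleExcess_sdiff_add_le [Finite V] (hv : v ∈ W) {m : ℕ}
    (hm : (W ∩ G.neighborSet v).ncard + m ≤
      (linkGraph G W v).edgeSet.ncard + Nat.card (linkGraph G W v).ConnectedComponent) :
    cycleExcess G (W \ {v}) + m ≤ cycleExcess G W := by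
  have hcycles := ncard_inducedCyclesIn_sdiff_add_le (G := G) hv
  have hedges := ncard_edgeSet_induce_eq (G := G) hv
  have hcomps := card_connectedComponent_induce_add_le (G := G) hv
  have hverts := Set.ncard_sdiff_singleton_add_one hv
  unfold cycleExcess
  omega

theorem cycleExcess_mono [Finite V] {A B : Set V} (hAB : A ⊆ B) :
    cycleExcess G A ≤ cycleExcess G B := by
  induction B using WellFoundedLT.induction with
  | _ B ih =>
    rcases hAB.eq_or_ssubset with rfl | hss
    · rfl
    · obtain ⟨v, hvB, hvA⟩ := Set.exists_of_ssubset hss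
      have hlt : B \ {v} < B := Set.sdiff_singleton_ssubset.2 hvB
      have hstep := cycleExcess_sdiff_add_le (G := G) (m := 0) hvB
        (by simpa using card_le_ncard_edgeSet_add_card_connectedComponent (linkGraph G B v))
      have := ih _ hlt (Set.subset_sdiff_singleton hAB hvA)
      push_cast at hstep
      omega

lemma cycleExcess_nonneg [Finite V] (W : Set V) : 0 ≤ cycleExcess G W := by
  have hempty : 0 ≤ cycleExcess G ∅ := by
    simp [cycleExcess]
  exact hempty.trans (cycleExcess_mono W.empty_subset)

lemma cycleExcess_univ (G : SimpleGraph V) : cycleExcess G Set.univ =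
    G.inducedCycles.ncard + Nat.card V - G.edgeSet.ncard - Nat.card G.ConnectedComponent := by
  have hedges : ((⊤ : G.Subgraph).induce Set.univ).edgeSet = G.edgeSet := by
    rw [← Subgraph.verts_top, Subgraph.induce_self_verts, Subgraph.edgeSet_top]
  rw [cycleExcess, hedges, Nat.card_congr (induceUnivIso G).connectedComponentEquiv, Set.ncard_univ]
  simp [inducedCyclesIn]

end LinkGraph

section Colouring

variable {V : Type*} {G : SimpleGraph V}

/-- The vertices of `W` outside `D` that are adjacent to no vertex of `D`. -/
def exteriorIn (G : SimpleGraph V) (W D : Set V) : Set V :=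
  {r ∈ W \ D | ∀ z ∈ D, ¬ G.Adj r z}

/-- The vertices of `W` outside `D` that are adjacent to a vertex of `D`. -/
def boundaryIn (G : SimpleGraph V) (W D : Set V) : Set V :=
  {s ∈ W \ D | ∃ z ∈ D, G.Adj s z}

theorem choose_two_add_cycleExcess_le [Finite V] {W K : Set V} {v : V} {k : ℕ} (hv : v ∈ W)
    (hK : K ⊆ W ∩ G.neighborSet v) (hk : K.ncard = k + 1) (hlink : K.Pairwise (Linked G W v)) :
    cycleExcess G (W \ {v}) + k.choose 2 ≤ cycleExcess G W := by
  have hclique : (linkGraph G W v).IsClique (Subtype.val ⁻¹' K) :=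
    fun x hx y hy hxy => hlink hx hy (Subtype.coe_ne_coe.2 hxy)
  have hcard : (Subtype.val ⁻¹' K : Set ↥(W ∩ G.neighborSet v)).ncard = k + 1 := by
    rw [Set.ncard_preimage_of_injective_subset_range Subtype.val_injective, hk]
    exact hK.trans_eq Subtype.range_coe.symm
  refine cycleExcess_sdiff_add_le hv ?_
  rw [← Nat.card_coe_set_eq]
  exact card_add_choose_le_of_isClique hclique hcard

lemma exists_connected_induce_exteriorIn_adj_boundaryIn [Finite V] {W : Set V}
    (hW : ¬ G.IsClique W) :
    ∃ D ⊆ W, (G.induce D).Connected ∧ (exteriorIn G W D).Nonempty ∧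
      ∀ r ∈ exteriorIn G W D, ∀ s ∈ boundaryIn G W D, G.Adj r s := by
  obtain ⟨a, ha, b, hb, hab, hnadj⟩ : ∃ a ∈ W, ∃ b ∈ W, a ≠ b ∧ ¬ G.Adj a b := by
    simpa [IsClique, Set.Pairwise] using hW
  let P : Set V → Prop := fun D => D ⊆ W ∧ (G.induce D).Connected ∧ (exteriorIn G W D).Nonempty
  have hPa : P {a} := by
    refine ⟨Set.singleton_subset_iff.2 ha, ⟨Preconnected.of_subsingleton⟩, b, ⟨hb, hab.symm⟩, ?_⟩
    rintro _ rfl h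
    exact hnadj h.symm
  obtain ⟨D, -, ⟨hDW, hDc, hext⟩, hmax⟩ := (Set.toFinite {D | P D}).exists_le_maximal hPa
  refine ⟨D, hDW, hDc, hext, fun r hr s ⟨⟨hsW, hsD⟩, z, hz, hsz⟩ => ?_⟩
  by_contra hrs
  have hD' : P (D ∪ {s}) := by
    refine ⟨Set.union_subset hDW (Set.singleton_subset_iff.2 hsW),
      connected_induce_union hDc.preconnected Preconnected.of_subsingleton hz rfl hsz.symm,
      r, ⟨hr.1.1, ?_⟩, ?_⟩
    · rintro (h | rfl)
      · exact hr.1.2 h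
      · exact hr.2 z hz hsz
    · rintro w (hw | rfl)
      · exact hr.2 w hw
      · exact hrs
  exact hsD (hmax hD' Set.subset_union_left (Or.inr rfl))

lemma inter_neighborSet_eq_union_boundaryIn {W D : Set V}
    (hadj : ∀ r ∈ exteriorIn G W D, ∀ s ∈ boundaryIn G W D, G.Adj r s) {r : V}
    (hr : r ∈ exteriorIn G W D) :
    W ∩ G.neighborSet r = (exteriorIn G W D ∩ G.neighborSet r) ∪ boundaryIn G W D := by
  ext x
  constructor
  · rintro ⟨hxW, hrx⟩
    have hxD : x ∈ W \ D := ⟨hxW, fun hx => hr.2 x hx hrx⟩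
    by_cases hx : ∃ z ∈ D, G.Adj x z
    · exact Or.inr ⟨hxD, hx⟩
    · push Not at hx
      exact Or.inl ⟨⟨hxD, hx⟩, hrx⟩
  · rintro (⟨hx, hrx⟩ | hx)
    · exact ⟨hx.1.1, hrx⟩
    · exact ⟨hx.1.1, hadj r hr x hx⟩

lemma disjoint_exteriorIn_boundaryIn {W D : Set V} :
    Disjoint (exteriorIn G W D) (boundaryIn G W D) :=
  Set.disjoint_left.2 fun _ hx ⟨_, z, hz, hxz⟩ => hx.2 z hz hxz

lemma Linked.of_mem_boundaryIn {W D : Set V} (hDW : D ⊆ W) (hD : (G.induce D).Connected) {v : V}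
    (hv : v ∈ exteriorIn G W D) {x y : V} (hx : x ∈ boundaryIn G W D)
    (hy : y ∈ boundaryIn G W D) (hvx : G.Adj v x) (hvy : G.Adj v y) (hxy : x ≠ y) :
    Linked G W v x y := by
  obtain ⟨⟨hxW, -⟩, z, hz, hxz⟩ := hx
  obtain ⟨⟨hyW, -⟩, w, hw, hyw⟩ := hy
  have hcx := connected_induce_union hD.preconnected
    (Preconnected.of_subsingleton (G := G.induce {x})) hz rfl hxz.symm
  have hcxy := connected_induce_union hcx.preconnected
    (Preconnected.of_subsingleton (G := G.induce {y})) (Or.inl hw) rfl hyw.symm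
  refine ⟨hxy, D ∪ {x} ∪ {y}, ?_, hcxy, ?_⟩
  · rintro t ((ht | rfl) | rfl)
    · exact ⟨hDW ht, fun h => hv.1.2 (h ▸ ht)⟩
    · exact ⟨hxW, hvx.ne'⟩
    · exact ⟨hyW, hvy.ne'⟩
  · ext t
    constructor
    · rintro ⟨(ht | rfl) | rfl, hvt⟩
      · exact absurd hvt (hv.2 t ht)
      · exact Or.inl rfl
      · exact Or.inr rfl
    · rintro (rfl | rfl)
      · exact ⟨Or.inl (Or.inr rfl), hvx⟩
      · exact ⟨Or.inr rfl, hvy⟩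

theorem exists_linked_clique [Finite V] {W : Set V} (hW : W.Nonempty) {k : ℕ}
    (hdeg : ∀ v ∈ W, k ≤ (W ∩ G.neighborSet v).ncard) :
    ∃ v ∈ W, ∃ K ⊆ W ∩ G.neighborSet v, K.ncard = k ∧ K.Pairwise (Linked G W v) := by
  induction W using WellFoundedLT.induction generalizing k with
  | _ W ih =>
    by_cases hclique : G.IsClique W
    · obtain ⟨v, hv⟩ := hW
      obtain ⟨K, hK, hKk⟩ := Set.exists_subset_card_eq (hdeg v hv)
      exact ⟨v, hv, K, hK, hKk, fun x hx y hy hxy =>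
        Linked.of_adj (hK hx) (hK hy) (hclique (hK hx).1 (hK hy).1 hxy)⟩
    obtain ⟨D, hDW, hD, hR, hadj⟩ := exists_connected_induce_exteriorIn_adj_boundaryIn hclique
    set R := exteriorIn G W D
    set S := boundaryIn G W D
    have hRW : R ⊆ W := fun r hr => hr.1.1
    have hRss : R < W := by
      obtain ⟨⟨d, hd⟩⟩ := hD.nonempty
      exact Set.ssubset_iff_exists.2 ⟨hRW, d, hDW hd, fun h => h.1.2 hd⟩
    have hdegR : ∀ r ∈ R, k - S.ncard ≤ (R ∩ G.neighborSet r).ncard := fun r hr => by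
      have := hdeg r (hRW hr)
      rw [inter_neighborSet_eq_union_boundaryIn hadj hr] at this
      exact Nat.sub_le_iff_le_add.2 (this.trans (Set.ncard_union_le _ _))
    obtain ⟨v, hv, K, hK, hKk, hlink⟩ := ih R hRss hR hdegR
    have hKS : K ∪ S ⊆ W ∩ G.neighborSet v := by
      rw [inter_neighborSet_eq_union_boundaryIn hadj hv]
      exact Set.union_subset_union_left S hK
    have hcard : k ≤ (K ∪ S).ncard := by
      rw [Set.ncard_union_eq (disjoint_exteriorIn_boundaryIn.mono_left fun x hx => (hK hx).1), hKk]
      exact Nat.sub_le_iff_le_add.1 le_rfl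
    have hlinkKS : (K ∪ S).Pairwise (Linked G W v) := by
      have : Std.Symm (Linked G W v) := ⟨fun _ _ h => h.symm⟩
      refine Set.pairwise_union_of_symm.2 ⟨?_, ?_, ?_⟩
      · exact hlink.mono' fun _ _ h => h.mono hRW
      · exact fun x hx y hy hxy =>
          Linked.of_mem_boundaryIn hDW hD hv hx hy (hadj v hv x hx) (hadj v hv y hy) hxy
      · exact fun x hx y hy _ => Linked.of_adj (hKS (Or.inl hx)) (hKS (Or.inr hy))
          (hadj x (hK hx).1 y hy)
    obtain ⟨K', hK', hK'k⟩ := Set.exists_subset_card_eq hcard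
    exact ⟨v, hRW hv, K', hK'.trans hKS, hK'k, hlinkKS.mono hK'⟩

theorem choose_three_le_cycleExcess [Finite V] {W : Set V} (hW : W.Nonempty) {n : ℕ}
    (hdeg : ∀ v ∈ W, n ≤ (W ∩ G.neighborSet v).ncard) : n.choose 3 ≤ cycleExcess G W := by
  induction n generalizing W with
  | zero => exact cycleExcess_nonneg W
  | succ n ih =>
    obtain ⟨v, hv, K, hK, hKn, hlink⟩ := exists_linked_clique hW hdeg
    have hstep := choose_two_add_cycleExcess_le hv hK hKn hlink
    have hne : (W \ {v}).Nonempty := by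
      obtain ⟨x, hx⟩ := (Set.ncard_pos).1 (n.succ_pos.trans_le (hdeg v hv))
      exact ⟨x, mem_sdiff_of_mem_neighborSet hx⟩
    have hdeg' : ∀ w ∈ W \ {v}, n ≤ (W \ {v} ∩ G.neighborSet w).ncard := fun w hw => by
      rw [Set.sdiff_inter_right_comm]
      have := Set.ncard_le_ncard_sdiff_add_ncard (W ∩ G.neighborSet w) {v}
      have := hdeg w hw.1
      rw [Set.ncard_singleton] at *
      omega
    have := ih hne hdeg'
    rw [Nat.choose_succ_succ' n 2]
    push_cast
    omega

theorem colorable_of_forall_exists_ncard_lt [Finite V] {n : ℕ}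
    (h : ∀ W : Set V, W.Nonempty → ∃ v ∈ W, (W ∩ G.neighborSet v).ncard < n) : G.Colorable n := by
  suffices hpartial : ∀ W : Set V, ∃ C : V → ℕ,
      (∀ x ∈ W, C x < n) ∧ ∀ x ∈ W, ∀ y ∈ W, G.Adj x y → C x ≠ C y by
    obtain ⟨C, hlt, hvalid⟩ := hpartial Set.univ
    exact (colorable_iff_exists_bdd_nat_coloring n).2
      ⟨Coloring.mk C fun hxy => hvalid _ trivial _ trivial hxy, fun x => hlt x trivial⟩
  classical
  intro W
  induction W using WellFoundedLT.induction with
  | _ W ih =>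
    rcases W.eq_empty_or_nonempty with rfl | hW
    · exact ⟨0, by simp, by simp⟩
    obtain ⟨v, hv, hdeg⟩ := h W hW
    obtain ⟨C, hlt, hvalid⟩ := ih (W \ {v}) (Set.sdiff_singleton_ssubset.2 hv)
    obtain ⟨a, han, ha⟩ : ∃ a ∈ Set.Iio n, a ∉ C '' (W ∩ G.neighborSet v) := by
      refine Set.exists_mem_notMem_of_ncard_lt_ncard ((Set.ncard_image_le).trans_lt ?_)
      rwa [Set.ncard_Iio_nat]
    refine ⟨Function.update C v a, fun x hx => ?_, fun x hx y hy hxy => ?_⟩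
    · rcases eq_or_ne x v with rfl | hxv
      · rwa [Function.update_self]
      · rw [Function.update_of_ne hxv]
        exact hlt x ⟨hx, hxv⟩
    · rcases eq_or_ne x v with rfl | hxv
      · rw [Function.update_self, Function.update_of_ne hxy.ne']
        exact fun h => ha ⟨y, ⟨hy, hxy⟩, h.symm⟩
      · rcases eq_or_ne y v with rfl | hyv
        · rw [Function.update_self, Function.update_of_ne hxy.ne]
          exact fun h => ha ⟨x, ⟨hx, hxy.symm⟩, h⟩
        · rw [Function.update_of_ne hxv, Function.update_of_ne hyv]
          exact hvalid x ⟨hx, hxv⟩ y ⟨hy, hyv⟩ hxy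

theorem ncard_edgeSet_add_choose_three_le_of_not_colorable [Finite V] {n : ℕ}
    (hG : ¬ G.Colorable n) :
    G.edgeSet.ncard + Nat.card G.ConnectedComponent + n.choose 3 ≤
      G.inducedCycles.ncard + Nat.card V := by
  obtain ⟨W, hW, hdeg⟩ : ∃ W : Set V, W.Nonempty ∧ ∀ v ∈ W, n ≤ (W ∩ G.neighborSet v).ncard := by
    by_contra! h
    exact hG (colorable_of_forall_exists_ncard_lt h)
  have hmono := (choose_three_le_cycleExcess hW hdeg).trans (cycleExcess_mono W.subset_univ)
  rw [cycleExcess_univ] at hmono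
  omega

end Colouring

section ContinuousLog

variable {X : Type*} [TopologicalSpace X]

/-- `f` has a continuous logarithm on `s`, i.e. it represents the zero class in the first integral
cohomology group of `s`. -/
def HasContinuousLogOn (f : X → ℂ) (s : Set X) : Prop :=
  ∃ g : X → ℂ, ContinuousOn g s ∧ ∀ x ∈ s, Complex.exp (g x) = f x

lemma HasContinuousLogOn.mono {f : X → ℂ} {s t : Set X} (h : HasContinuousLogOn f t)
    (hst : s ⊆ t) : HasContinuousLogOn f s := by
  obtain ⟨g, hg, hexp⟩ := h
  exact ⟨g, hg.mono hst, fun x hx => hexp x (hst hx)⟩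

lemma hasContinuousLogOn_univ [SimplyConnectedSpace X] [LocallyPathConnectedSpace X] {f : X → ℂ}
    (hf : Continuous f) (h0 : ∀ x, f x ≠ 0) : HasContinuousLogOn f Set.univ := by
  have huniv : IsSimplyConnected (Set.univ : Set X) :=
    (Homeomorph.Set.univ X).toHomotopyEquiv.simplyConnectedSpace_iff.2 ‹_›
  have h0' : 0 ∉ f '' Set.univ := fun ⟨x, _, hx⟩ => h0 x hx
  exact Complex.exists_continuousOn_eqOn_exp_comp huniv isOpen_univ hf.continuousOn h0'

lemma hasContinuousLogOn_range_path [T2Space X] {x y : X} {γ : Path x y}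
    (hγ : Function.Injective γ) {f : X → ℂ} (hf : ContinuousOn f (Set.range γ))
    (h0 : ∀ z ∈ Set.range γ, f z ≠ 0) : HasContinuousLogOn f (Set.range γ) := by
  have hmem : ∀ t, γ.extend t ∈ Set.range γ := fun t => γ.extend_range ▸ Set.mem_range_self t
  obtain ⟨L, hL, hexp⟩ := hasContinuousLogOn_univ (f := f ∘ γ.extend)
    (hf.comp_continuous γ.continuous_extend hmem) fun t => h0 _ (hmem t)
  let ℓ : unitInterval → ℂ := fun t => L t
  have hℓ : Function.extend γ ℓ 0 ∘ γ = ℓ := Function.extend_comp hγ ℓ 0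
  refine ⟨Function.extend γ ℓ 0, ?_, ?_⟩
  · have hemb := γ.continuous.isClosedEmbedding hγ
    rw [← Set.image_univ, hemb.isInducing.continuousOn_image_iff, hℓ, continuousOn_univ]
    exact (continuousOn_univ.1 hL).comp continuous_subtype_val
  · rintro _ ⟨t, rfl⟩
    rw [hγ.extend_apply, hexp _ trivial, Function.comp_apply, γ.extend_apply]

/-- The winding number of `(z - c) ^ k` is `k`. -/
theorem eq_zero_of_hasContinuousLogOn_sphere {c : ℂ} {r : ℝ} (hr : 0 < r) {k : ℤ}
    (h : HasContinuousLogOn (fun z => (z - c) ^ k) (Metric.sphere c r)) : k = 0 := by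
  obtain ⟨L, hL, hexp⟩ := h
  let φ : ℝ → ℂ := fun t => L (circleMap c r t) - k * (t * Complex.I)
  have hφ : Continuous φ :=
    (hL.comp_continuous (continuous_circleMap c r) (circleMap_mem_sphere c hr.le)).sub
      (by fun_prop)
  have hexpφ : ∀ t, Complex.exp (φ t) = (r : ℂ) ^ k := fun t => by
    have hz : Complex.exp (L (circleMap c r t)) = (circleMap c r t - c) ^ k :=
      hexp _ (circleMap_mem_sphere c hr.le t)
    rw [Complex.exp_sub, hz, circleMap_sub_center, circleMap_zero, Complex.exp_int_mul, mul_zpow,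
      mul_div_cancel_right₀ _ (zpow_ne_zero _ (Complex.exp_ne_zero _))]
  have hconst : φ = fun _ => φ 0 :=
    Complex.isCoveringMap_exp.eq_of_comp_eq hφ continuous_const
      (funext fun t => Subtype.ext ((hexpφ t).trans (hexpφ 0).symm)) 0 rfl
  have hperiod : φ (2 * Real.pi) = φ 0 := congrFun hconst _
  have hcircle : circleMap c r (2 * Real.pi) = circleMap c r 0 := by
    simpa only [zero_add] using periodic_circleMap c r 0
  simp only [φ, hcircle, Complex.ofReal_zero, zero_mul, mul_zero, sub_zero, sub_eq_self] at hperiod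
  simpa [Real.pi_ne_zero] using hperiod

/-- Otherwise `(z - c) ^ k` on the complement of `U` and `exp g / f` on `U`, for a continuous
extension `g` of the logarithm, would glue to a function on `ℂ` without zeros, which has a
continuous logarithm on large circles around `c`. -/
theorem eq_zero_of_hasContinuousLogOn_frontier {U : Set ℂ} (hU : IsOpen U)
    (hUb : Bornology.IsBounded U) {c : ℂ} (hc : c ∈ U) {f : ℂ → ℂ} (hf : ContinuousOn f (closure U))
    (hf0 : ∀ z ∈ closure U, f z ≠ 0) {k : ℤ}
    (h : HasContinuousLogOn (fun z => f z * (z - c) ^ k) (frontier U)) : k = 0 := by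
  classical
  obtain ⟨g, hg, hexp⟩ := h
  obtain ⟨g', hg'⟩ := ContinuousMap.exists_restrict_eq isClosed_frontier
    ⟨(frontier U).domRestrict g, continuousOn_iff_continuous_domRestrict.1 hg⟩
  have hgg' : ∀ z ∈ frontier U, g' z = g z := fun z hz =>
    congrArg (fun F : C(frontier U, ℂ) => F ⟨z, hz⟩) hg'
  have hne : ∀ z ∉ U, z - c ≠ 0 := fun z hz => sub_ne_zero.2 (ne_of_mem_of_not_mem hc hz).symm
  let F : ℂ → ℂ := U.piecewise (fun z => Complex.exp (g' z) / f z) fun z => (z - c) ^ k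
  have hF : Continuous F := by
    refine continuous_piecewise (fun z hz => ?_) ?_ ?_
    · rw [hgg' z hz, hexp z hz, mul_div_cancel_left₀ _ (hf0 z (frontier_subset_closure hz))]
    · exact (Complex.continuous_exp.comp g'.continuous).continuousOn.div hf hf0
    · rw [hU.isClosed_compl.closure_eq]
      exact (continuous_id.sub continuous_const).continuousOn.zpow₀ k fun z hz => Or.inl (hne z hz)
  have hFU : ∀ z ∈ U, F z = Complex.exp (g' z) / f z := fun z => Set.piecewise_eq_of_mem _ _ _
  have hFUc : ∀ z ∉ U, F z = (z - c) ^ k := fun z => Set.piecewise_eq_of_notMem _ _ _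
  have hF0 : ∀ z, F z ≠ 0 := fun z => by
    by_cases hz : z ∈ U
    · rw [hFU z hz]
      exact div_ne_zero (Complex.exp_ne_zero _) (hf0 z (subset_closure hz))
    · rw [hFUc z hz]
      exact zpow_ne_zero k (hne z hz)
  obtain ⟨r, hr, hUr⟩ := hUb.subset_ball_lt 0 c
  obtain ⟨L, hL, hLF⟩ := (hasContinuousLogOn_univ hF hF0).mono (Metric.sphere c r).subset_univ
  refine eq_zero_of_hasContinuousLogOn_sphere hr ⟨L, hL, fun z hz => ?_⟩
  have hzU : z ∉ U := fun hzU => (Metric.mem_ball.1 (hUr hzU)).ne hz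
  rw [hLF z hz, hFUc z hzU]

end ContinuousLog

section Complement

lemma frontier_connectedComponentIn_compl_subset {X : Type*} [TopologicalSpace X]
    [LocallyConnectedSpace X] {K : Set X} (hK : IsClosed K) (x : X) :
    frontier (connectedComponentIn Kᶜ x) ⊆ K := by
  intro z hz
  by_contra hzK
  obtain ⟨w, hwz, hwx⟩ := mem_closure_iff.1 hz.1 _ hK.isOpen_compl.connectedComponentIn
    (mem_connectedComponentIn hzK)
  rw [hK.isOpen_compl.connectedComponentIn.frontier_eq] at hz
  exact hz.2 (connectedComponentIn_eq hwx ▸ connectedComponentIn_eq hwz ▸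
    mem_connectedComponentIn hzK)

/-- Eilenberg's criterion: on the closure of the component of `p i` only the factor `z - p i`
vanishes, so the winding number around `p i` isolates `k i`. -/
theorem eq_zero_of_hasContinuousLogOn_prod_zpow_sub {K : Set ℂ} (hK : IsClosed K) {ι : Type*}
    [Fintype ι] {p : ι → ℂ} (hp : ∀ i, p i ∉ K)
    (hinj : Function.Injective fun i => connectedComponentIn Kᶜ (p i))
    (hbdd : ∀ i, Bornology.IsBounded (connectedComponentIn Kᶜ (p i))) {k : ι → ℤ}
    (h : HasContinuousLogOn (fun z => ∏ i, (z - p i) ^ k i) K) : k = 0 := by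
  classical
  funext i
  have hU : IsOpen (connectedComponentIn Kᶜ (p i)) := hK.isOpen_compl.connectedComponentIn
  have hfr := frontier_connectedComponentIn_compl_subset hK (p i)
  have hne : ∀ z ∈ closure (connectedComponentIn Kᶜ (p i)), ∀ j ∈ Finset.univ.erase i,
      z - p j ≠ 0 := fun z hz j hj => by
    refine sub_ne_zero.2 ?_
    rintro rfl
    by_cases hj' : p j ∈ connectedComponentIn Kᶜ (p i)
    · exact Finset.ne_of_mem_erase hj (hinj (connectedComponentIn_eq hj').symm)
    · exact hp j (hfr ⟨hz, hU.interior_eq.symm ▸ hj'⟩)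
  refine eq_zero_of_hasContinuousLogOn_frontier hU (hbdd i) (mem_connectedComponentIn (hp i))
    (f := fun z => ∏ j ∈ Finset.univ.erase i, (z - p j) ^ k j) ?_ ?_ ?_
  · exact continuousOn_finsetProd _ fun j hj =>
      (continuous_id.sub continuous_const).continuousOn.zpow₀ (k j) fun z hz =>
        Or.inl (hne z hz j hj)
  · exact fun z hz => Finset.prod_ne_zero_iff.2 fun j hj => zpow_ne_zero _ (hne z hz j hj)
  · simp only [Finset.prod_erase_mul _ _ (Finset.mem_univ i)]
    exact h.mono hfr

variable {E : Type*} [NormedAddCommGroup E] [NormedSpace ℝ E]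

lemma isPreconnected_compl_closedBall (hE : 1 < Module.rank ℝ E) {r : ℝ} (hr : 0 ≤ r) :
    IsPreconnected (Metric.closedBall (0 : E) r)ᶜ := by
  have himage : (Metric.closedBall (0 : E) r)ᶜ =
      (fun q : ℝ × E => q.1 • q.2) '' (Set.Ioi r ×ˢ Metric.sphere (0 : E) 1) := by
    ext z
    simp only [Set.mem_compl_iff, mem_closedBall_zero_iff, not_le]
    constructor
    · intro hz
      have hz0 : ‖z‖ ≠ 0 := (hr.trans_lt hz).ne'
      exact ⟨(‖z‖, ‖z‖⁻¹ • z), ⟨hz, by simp [norm_smul, hz0]⟩, by simp [smul_smul, hz0]⟩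
    · rintro ⟨⟨t, w⟩, ⟨ht : r < t, hw⟩, rfl⟩
      rwa [norm_smul, mem_sphere_zero_iff_norm.1 hw, mul_one,
        Real.norm_of_nonneg (hr.trans ht.le)]
  rw [himage]
  exact (isPreconnected_Ioi.prod (isPreconnected_sphere hE 0 1)).image _ (by fun_prop)

theorem connectedComponentIn_compl_eq_of_not_isBounded (hE : 1 < Module.rank ℝ E) {K : Set E}
    (hK : Bornology.IsBounded K) {x y : E}
    (hx : ¬ Bornology.IsBounded (connectedComponentIn Kᶜ x))
    (hy : ¬ Bornology.IsBounded (connectedComponentIn Kᶜ y)) :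
    connectedComponentIn Kᶜ x = connectedComponentIn Kᶜ y := by
  obtain ⟨r, hr, hKr⟩ := hK.subset_closedBall_lt 0 0
  have hfar : ∀ A : Set E, ¬ Bornology.IsBounded A → ∃ z ∈ A, z ∉ Metric.closedBall 0 r :=
    fun A hA => Set.not_subset.1 fun h => hA (Metric.isBounded_closedBall.subset h)
  obtain ⟨z, hzx, hz⟩ := hfar _ hx
  obtain ⟨w, hwy, hw⟩ := hfar _ hy
  have hwz : w ∈ connectedComponentIn Kᶜ z :=
    (isPreconnected_compl_closedBall hE hr.le).subset_connectedComponentIn hz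
      (Set.compl_subset_compl.2 hKr) hw
  rw [connectedComponentIn_eq hzx, connectedComponentIn_eq hwz, connectedComponentIn_eq hwy]

lemma connectedComponentIn_eq_connectedComponentIn_iff {X : Type*} [TopologicalSpace X] {s : Set X}
    {x y : s} : connectedComponentIn s x = connectedComponentIn s y ↔
      (x : ConnectedComponents s) = y := by
  rw [connectedComponentIn_eq_image x.2, connectedComponentIn_eq_image y.2,
    (Set.image_injective.2 Subtype.val_injective).eq_iff, ConnectedComponents.coe_eq_coe]

theorem card_connectedComponents_compl_le {K : Set ℂ} (hK : IsCompact K) {n : ℕ}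
    (h : ∀ p : Fin (n + 1) → ℂ, (∀ i, p i ∉ K) → ∃ k : Fin (n + 1) → ℤ, k ≠ 0 ∧
      HasContinuousLogOn (fun z => ∏ i, (z - p i) ^ k i) K) :
    ENat.card (ConnectedComponents ↥Kᶜ) ≤ n + 1 := by
  choose q hq using ConnectedComponents.surjective_coe (α := ↥Kᶜ)
  have hq_inj : Function.Injective fun c => connectedComponentIn Kᶜ (q c) := fun c c' hcc' => by
    rw [← hq c, ← hq c']
    exact connectedComponentIn_eq_connectedComponentIn_iff.1 hcc'
  let B : Set (ConnectedComponents ↥Kᶜ) :=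
    {c | Bornology.IsBounded (connectedComponentIn Kᶜ (q c : ℂ))}
  have hBc : Bᶜ.encard ≤ 1 := Set.encard_le_one_iff.2 fun c c' hc hc' =>
    hq_inj (connectedComponentIn_compl_eq_of_not_isBounded (by simp) hK.isBounded hc hc')
  have hB : B.encard ≤ n := by
    by_contra! hlt
    obtain ⟨T, hTB, hT⟩ := Set.exists_subset_encard_eq (Order.add_one_le_of_lt hlt)
    have hTfin : T.Finite := Set.finite_of_encard_eq_coe (k := n + 1) hT
    have : Finite T := hTfin
    have hTcard : Nat.card T = n + 1 := by
      rw [Nat.card_coe_set_eq, Set.ncard, hT]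
      rfl
    let e : Fin (n + 1) ≃ T := (Finite.equivFinOfCardEq hTcard).symm
    obtain ⟨k, hk, hlog⟩ := h (fun i => q (e i)) fun i => (q (e i)).2
    exact hk (eq_zero_of_hasContinuousLogOn_prod_zpow_sub hK.isClosed (fun i => (q (e i)).2)
      (hq_inj.comp (Subtype.val_injective.comp e.injective)) (fun i => hTB (e i).2) hlog)
  rw [← Set.encard_univ, ← Set.union_compl_self B]
  exact (Set.encard_union_le _ _).trans (add_le_add hB hBc)

end Complement

/-- The bijection between sets of connected components that a homeomorphism induces, by which
regions of the plane are counted in `ℂ`. -/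
noncomputable def connectedComponentsEquiv {X Y : Type*} [TopologicalSpace X] [TopologicalSpace Y]
    (φ : X ≃ₜ Y) : ConnectedComponents X ≃ ConnectedComponents Y :=
  (φ.isQuotientMap.isCoinducing.connectedComponentsHomeomorph fun y => by
    rw [← φ.coe_toEquiv, ← φ.toEquiv.image_symm_eq_preimage, Set.image_singleton]
    exact isConnected_singleton).toEquiv

lemma exists_eqOn_of_pairwise_eqOn {X Y ι : Type*} [Nonempty Y] {S : ι → Set X} {g : ι → X → Y}
    (hg : ∀ i j, Set.EqOn (g i) (g j) (S i ∩ S j)) : ∃ f : X → Y, ∀ i, Set.EqOn f (g i) (S i) := by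
  classical
  refine ⟨fun x => if h : ∃ i, x ∈ S i then g h.choose x else Classical.arbitrary Y,
    fun i x hx => ?_⟩
  have h : ∃ i, x ∈ S i := ⟨i, hx⟩
  exact (dif_pos h).trans (hg _ _ ⟨h.choose_spec, hx⟩)

namespace PlaneDrawing

variable {V : Type*} {G : SimpleGraph V}

lemma exists_path_range_eq_arc (D : PlaneDrawing G) {e : G.edgeSet} {u v : V}
    (he : (e : Sym2 V) = s(u, v)) :
    ∃ γ : Path (D.point u) (D.point v), Function.Injective γ ∧ Set.range γ = D.arc e := by
  obtain ⟨e, hadj⟩ := e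
  subst he
  exact D.arc_isArc u v hadj

lemma point_mem_arc (D : PlaneDrawing G) {e : G.edgeSet} {w : V} (hw : w ∈ (e : Sym2 V)) :
    D.point w ∈ D.arc e := by
  obtain ⟨v, he⟩ := hw
  obtain ⟨γ, -, hγ⟩ := D.exists_path_range_eq_arc he
  exact hγ ▸ ⟨0, γ.source⟩

lemma point_mem_support (D : PlaneDrawing G) (v : V) : D.point v ∈ D.support :=
  Or.inl (Set.mem_range_self v)

lemma arc_subset_support (D : PlaneDrawing G) (e : G.edgeSet) : D.arc e ⊆ D.support :=
  (Set.subset_iUnion D.arc e).trans Set.subset_union_right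

lemma isCompact_arc (D : PlaneDrawing G) (e : G.edgeSet) : IsCompact (D.arc e) := by
  induction he : (e : Sym2 V) with
  | _ u v =>
    obtain ⟨γ, -, hγ⟩ := D.exists_path_range_eq_arc he
    exact hγ ▸ isCompact_range γ.continuous

lemma isCompact_support [Finite V] (D : PlaneDrawing G) : IsCompact D.support :=
  (Set.finite_range D.point).isCompact.union (isCompact_iUnion D.isCompact_arc)

theorem exists_continuousOn_support [Finite V] (D : PlaneDrawing G) {Y : Type*} [TopologicalSpace Y]
    [Nonempty Y] (h : V → Y) (g : G.edgeSet → Plane → Y) (hg : ∀ e, ContinuousOn (g e) (D.arc e))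
    (hgh : ∀ e : G.edgeSet, ∀ w ∈ (e : Sym2 V), g e (D.point w) = h w) :
    ∃ f : Plane → Y, ContinuousOn f D.support ∧ (∀ w, f (D.point w) = h w) ∧
      ∀ e, Set.EqOn f (g e) (D.arc e) := by
  let S : V ⊕ G.edgeSet → Set Plane := Sum.elim (fun v => {D.point v}) D.arc
  have hS : D.support = ⋃ i, S i := by
    rw [Set.iUnion_sum]
    exact congrArg (· ∪ _) (Set.iUnion_singleton_eq_range _).symm
  have hpoint : ∀ v e, D.point v ∈ D.arc e → h v = g e (D.point v) := fun v e hv =>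
    (hgh e v (D.mem_of_point_mem_arc v e hv)).symm
  obtain ⟨f, hf⟩ := exists_eqOn_of_pairwise_eqOn (S := S) (g := Sum.elim (fun v _ => h v) g) <| by
    rintro (v | e) (w | e') x ⟨hx, hx'⟩
    · exact congrArg h (D.point_injective (hx.symm.trans hx'))
    · obtain rfl : x = D.point v := hx
      exact hpoint v e' hx'
    · obtain rfl : x = D.point w := hx'
      exact (hpoint w e hx).symm
    · obtain rfl | hee' := eq_or_ne e e'
      · rfl
      · obtain ⟨v, ⟨hv, hv'⟩, rfl⟩ := D.arc_inter_arc e e' hee' ⟨hx, hx'⟩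
        exact (hgh e v hv).trans (hgh e' v hv').symm
  refine ⟨f, ?_, fun w => hf (.inl w) rfl, fun e => hf (.inr e)⟩
  rw [hS]
  refine (locallyFinite_of_finite S).continuousOn_iUnion ?_ ?_
  · rintro (v | e)
    exacts [isClosed_singleton, (D.isCompact_arc e).isClosed]
  · rintro (v | e)
    exacts [continuousOn_singleton _ _, (hg e).congr (hf (.inr e))]

lemma exists_log_arc (D : PlaneDrawing G) {e : G.edgeSet} {a b : V} (he : (e : Sym2 V) = s(a, b))
    {f : Plane → ℂ} (hf : ContinuousOn f (D.arc e)) (hf0 : ∀ z ∈ D.arc e, f z ≠ 0) {l : V → ℂ}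
    (hl : ∀ v, Complex.exp (l v) = f (D.point v)) :
    ∃ (g : Plane → ℂ) (c : ℤ), ContinuousOn g (D.arc e) ∧ (∀ z ∈ D.arc e, Complex.exp (g z) = f z) ∧
      g (D.point a) = l a ∧ g (D.point b) = l b + c * (2 * Real.pi * Complex.I) := by
  obtain ⟨γ, hinj, hγ⟩ := D.exists_path_range_eq_arc he
  obtain ⟨g, hg, hexp⟩ : HasContinuousLogOn f (D.arc e) := by
    rw [← hγ] at hf hf0 ⊢
    exact hasContinuousLogOn_range_path hinj hf hf0
  have hends : ∀ w ∈ (e : Sym2 V), ∃ n : ℤ,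
      g (D.point w) = l w + n * (2 * Real.pi * Complex.I) := fun w hw =>
    Complex.exp_eq_exp_iff_exists_int.1 ((hexp _ (D.point_mem_arc hw)).trans (hl w).symm)
  obtain ⟨m, hm⟩ := hends a (he ▸ Sym2.mem_mk_left a b)
  obtain ⟨n, hn⟩ := hends b (he ▸ Sym2.mem_mk_right a b)
  refine ⟨fun z => g z - m * (2 * Real.pi * Complex.I), n - m, hg.sub continuousOn_const,
    fun z hz => ?_, ?_, ?_⟩
  · rw [Complex.exp_sub, hexp z hz, Complex.exp_int_mul_two_pi_mul_I, div_one]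
  · simp only [hm, add_sub_cancel_right]
  · simp only [hn, Int.cast_sub, sub_mul, add_sub_assoc]

/-- The first integral cohomology of the drawing has rank `|E| - |V|` plus the number of
components, so a larger number of nonvanishing functions is multiplicatively dependent. -/
theorem exists_hasContinuousLogOn_prod_zpow [Finite V] (D : PlaneDrawing G) {ι : Type*} [Fintype ι]
    {f : ι → Plane → ℂ} (hf : ∀ i, ContinuousOn (f i) D.support)
    (hf0 : ∀ i, ∀ z ∈ D.support, f i z ≠ 0)
    (hcard : G.edgeSet.ncard + Nat.card G.ConnectedComponent < Fintype.card ι + Nat.card V) :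
    ∃ k : ι → ℤ, k ≠ 0 ∧ HasContinuousLogOn (fun z => ∏ i, f i z ^ k i) D.support := by
  let τ : ℂ := 2 * Real.pi * Complex.I
  let l : ι → V → ℂ := fun i v => Complex.log (f i (D.point v))
  have hl : ∀ i v, Complex.exp (l i v) = f i (D.point v) := fun i v =>
    Complex.exp_log (hf0 i _ (D.point_mem_support v))
  obtain ⟨a, b, hab⟩ := exists_edgeSet_eq_mk G
  choose lam c hlam hexp hlama hlamb using fun i e => D.exists_log_arc (hab e)
    ((hf i).mono (D.arc_subset_support e)) (fun z hz => hf0 i z (D.arc_subset_support e hz)) (hl i)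
  obtain ⟨k, hk, d, hd⟩ := exists_sum_mul_eq_sub hab c hcard
  have hexp_sum : ∀ (u : ι → ℂ) (n : ℤ) (z : Plane), (∀ i, Complex.exp (u i) = f i z) →
      Complex.exp (∑ i, k i * u i + n * τ) = ∏ i, f i z ^ k i := fun u n z hu => by
    rw [Complex.exp_add, Complex.exp_int_mul_two_pi_mul_I, mul_one, Complex.exp_sum]
    exact Finset.prod_congr rfl fun i _ => by rw [Complex.exp_int_mul, hu]
  have hlamτ : ∀ e, ∑ i, (k i : ℂ) * lam i e (D.point (b e)) + d (a e) * τ =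
      ∑ i, (k i : ℂ) * l i (b e) + d (b e) * τ := fun e => by
    have hde : (∑ i, (k i : ℂ) * c i e) = d (b e) - d (a e) := by exact_mod_cast hd e
    simp only [hlamb, mul_add, Finset.sum_add_distrib, ← mul_assoc _ _ (2 * Real.pi * Complex.I),
      ← Finset.sum_mul, hde]
    ring
  obtain ⟨g, hg, hgpt, hgarc⟩ := D.exists_continuousOn_support
    (fun v => ∑ i, (k i : ℂ) * l i v + d v * τ)
    (fun e z => ∑ i, (k i : ℂ) * lam i e z + d (a e) * τ)
    (fun e => (continuousOn_finsetSum _ fun i _ => continuousOn_const.mul (hlam i e)).add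
      continuousOn_const) fun e w hw => by
        rw [hab e] at hw
        rcases Sym2.mem_iff.1 hw with rfl | rfl
        · simp only [hlama]
        · exact hlamτ e
  refine ⟨k, hk, g, hg, ?_⟩
  rintro z (⟨w, rfl⟩ | hz)
  · rw [hgpt, hexp_sum _ _ _ fun i => hl i w]
  · obtain ⟨e, hz⟩ := Set.mem_iUnion.1 hz
    rw [hgarc e hz]
    exact hexp_sum _ _ _ fun i => hexp i e z hz

theorem numRegions_add_card_le [Finite V] (D : PlaneDrawing G) :
    D.numRegions + Nat.card V ≤ G.edgeSet.ncard + 1 + Nat.card G.ConnectedComponent := by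
  let φ : Plane ≃ₜ ℂ := Complex.orthonormalBasisOneI.repr.symm.toHomeomorph
  have hK : IsCompact (φ '' D.support) := D.isCompact_support.image φ.continuous
  obtain ⟨n, hn⟩ := Nat.exists_eq_add_of_le
    (card_le_ncard_edgeSet_add_card_connectedComponent G)
  have hregions : ENat.card (ConnectedComponents ↥(φ '' D.support)ᶜ) ≤ n + 1 := by
    refine card_connectedComponents_compl_le hK fun p hp => ?_
    obtain ⟨k, hk, g, hg, hexp⟩ := D.exists_hasContinuousLogOn_prod_zpow
      (f := fun i z => φ z - p i) (fun i => (φ.continuous.sub continuous_const).continuousOn)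
      (fun i z hz => sub_ne_zero.2 (ne_of_mem_of_not_mem (Set.mem_image_of_mem φ hz) (hp i)))
      (by rw [Fintype.card_fin]; omega)
    refine ⟨k, hk, g ∘ φ.symm, ?_, ?_⟩
    · rw [φ.isInducing.continuousOn_image_iff]
      simpa [Function.comp_def] using hg
    · rintro _ ⟨z, hz, rfl⟩
      simpa using hexp z hz
  have hcompl : φ '' D.supportᶜ = (φ '' D.support)ᶜ := Set.image_compl_eq φ.bijective
  let ψ : ↥D.supportᶜ ≃ₜ ↥(φ '' D.support)ᶜ := (φ.image _).trans (.setCongr hcompl)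
  have hnum : D.numRegions ≤ n + 1 := by
    rw [numRegions, Nat.card_congr (connectedComponentsEquiv ψ)]
    exact ENat.toNat_le_of_le_natCast hregions
  omega

end PlaneDrawing

theorem corollary3p2p2_general {V : Type*} [Finite V] (G : SimpleGraph V) (D : PlaneDrawing G)
    {n : ℕ} (hC : G.inducedCycles.ncard + 1 < D.numRegions + n.choose 3) : G.Colorable n := by
  by_contra hcol
  have hcycles := ncard_edgeSet_add_choose_three_le_of_not_colorable hcol
  have hregions := D.numRegions_add_card_le
  omega

theorem corollary3p2p2 {V : Type*} [Finite V] (G : SimpleGraph V) (hG : G.Connected)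
    (D : PlaneDrawing G) (hC : G.inducedCycles.ncard ≤ D.numRegions + 2) :
    G.chromaticNumber ≤ 4 :=
  chromaticNumber_le_iff_colorable.2 <| corollary3p2p2_general G D <| by
    rw [show Nat.choose 4 3 = 4 from rfl]; omega
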